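/- Let $X$ be an extremally disconnected compact Hausdorff space, let $H$ be a complex Hilbert space, and let $C(X,B(H))$ be the $C^*$-algebra of all norm-continuous functions from $X$ to the algebra $B(H)$ of bounded linear operators on $H$, with pointwise operations and the uniform norm $\|a\|=\sup_{x\in X}\|a(x)\|$. A projection in $C(X,B(H))$ is an element $p$ with $p=p^*=p^2$, and projections $p,q$ are orthogonal if $pq=0$. Then: 1. The set of all linear combinations $\sum_{i=1}^n c_i p_i$, where $n\in\mathbb{N}$, $c_1,\dots,c_n\in\mathbb{R}$ and $p_1,\dots,p_n$ are pairwise orthogonal projections in $C(X,B(H))$, is uniformly dense in the self-adjoint part $C(X,B(H))_{sa}=\{a\in C(X,B(H)) : a=a^*\}$; that is, its closure in $C(X,B(H))$ equals $C(X,B(H))_{sa}$. 2. The set of all complex linear combinations of finitely many (not necessarily mutually orthogonal) projections in $C(X,B(H))$ is uniformly dense in $C(X,B(H))$. -/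

import Mathlib

/-- The set of all real-linear combinations `c₁ p₁ + ⋯ + cₙ pₙ` of finite families of pairwise
orthogonal projections (self-adjoint idempotents with `pᵢ pⱼ = 0` for `i ≠ j`) of a complex
`*`-algebra `A`. -/
def orthogonalProjectionCombinations (A : Type*) [Ring A] [StarRing A] [Algebra ℂ A] : Set A :=
  {a | ∃ (n : ℕ) (c : Fin n → ℝ) (p : Fin n → A),
    (∀ i, IsStarProjection (p i)) ∧ (∀ i j, i ≠ j → p i * p j = 0) ∧
      a = ∑ i, (c i : ℂ) • p i}

/-! As `X` is compact and totally disconnected, a continuous function is uniformly close to one that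
is constant on each piece of a finite clopen partition, so it suffices to approximate single
self-adjoint operators. With `S` the symmetry in `R = S|R|` and `‖R‖ ≤ 2δ`, `R - δS = S(|R| - δ)`
has norm at most `δ`. Iterating halves the error; the symmetries lie in the bicommutant, so their
projections commute and products refine the resolution. -/

/-- A real-linear combination of pairwise orthogonal projections indexed by any finite type lies in
`orthogonalProjectionCombinations`. -/
lemma sum_smul_mem_orthogonalProjectionCombinations {A : Type*} [Ring A] [StarRing A] [Algebra ℂ A]
    {ι : Type*} [Fintype ι] (c : ι → ℝ) (p : ι → A) (hp : ∀ i, IsStarProjection (p i))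
    (hpp : ∀ i j, i ≠ j → p i * p j = 0) :
    ∑ i, (c i : ℂ) • p i ∈ orthogonalProjectionCombinations A := by
  let e := (Fintype.equivFin ι).symm
  refine ⟨Fintype.card ι, c ∘ e, p ∘ e, fun i ↦ hp _, fun i j hij ↦ hpp _ _ (e.injective.ne hij), ?_⟩
  exact (e.sum_comp fun i ↦ (c i : ℂ) • p i).symm

lemma isSelfAdjoint_of_mem_orthogonalProjectionCombinations {A : Type*} [Ring A] [StarRing A]
    [Algebra ℂ A] [StarModule ℂ A] {a : A} (ha : a ∈ orthogonalProjectionCombinations A) :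
    IsSelfAdjoint a := by
  obtain ⟨n, c, p, hp, -, rfl⟩ := ha
  refine isSelfAdjoint_sum _ fun i _ ↦ IsSelfAdjoint.smul ?_ (hp i).isSelfAdjoint
  exact Complex.conj_ofReal _

lemma orthogonalProjectionCombinations_subset_span (A : Type*) [Ring A] [StarRing A]
    [Algebra ℂ A] :
    orthogonalProjectionCombinations A ⊆ Submodule.span ℂ {p : A | IsStarProjection p} := by
  rintro a ⟨n, c, p, hp, -, rfl⟩
  exact Submodule.sum_mem _ fun i _ ↦ Submodule.smul_mem _ _ (Submodule.subset_span (hp i))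

section Operator

variable {H : Type*} [NormedAddCommGroup H] [InnerProductSpace ℂ H] [CompleteSpace H]

/-- The projection onto the kernel of a self-adjoint operator `T` commutes with every operator
commuting with `T`. -/
lemma commute_starProjection_ker {T B : H →L[ℂ] H} (hT : IsSelfAdjoint T) (h : Commute T B) :
    Commute (T.ker.starProjection) B := by
  set Q := T.ker.starProjection
  have hQsa : star Q = Q := isSelfAdjoint_starProjection _
  -- Operators commuting with `T` leave its kernel invariant; as `T` is self-adjoint, this applies
  -- to both `B` and `star B`.
  have key : ∀ C : H →L[ℂ] H, Commute T C → Q * (C * Q) = C * Q := by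
    intro C hC
    ext x
    have hx : Q x ∈ T.ker := Submodule.starProjection_apply_mem _ _
    refine Submodule.starProjection_eq_self_iff.2 ?_
    have hx' : T (Q x) = 0 := hx
    change T (C (Q x)) = 0
    have := congrArg (fun S : H →L[ℂ] H ↦ S (Q x)) hC.eq
    simpa [hx'] using this
  have h1 := key B h
  have h2 := congrArg star (key (star B) (by simpa [hT.star_eq] using h.star_star))
  simp only [star_mul, star_star, hQsa] at h2
  rw [mul_assoc, h1] at h2
  exact h2.symm

/-- Approximation of a self-adjoint operator by a multiple of a symmetry from its bicommutant. -/
lemma exists_isStarProjection_norm_sub_smul_le {R : H →L[ℂ] H} (hR : IsSelfAdjoint R) {δ : ℝ}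
    (hδ : ‖R‖ ≤ 2 * δ) :
    ∃ q : H →L[ℂ] H, IsStarProjection q ∧ (∀ B, Commute R B → Commute q B) ∧
      ‖R - δ • (q - (1 - q))‖ ≤ δ := by
  have hpos : IsSelfAdjoint R⁺ := (CFC.posPart_nonneg R).isSelfAdjoint
  set Q := (R⁺).ker.starProjection
  have hQp : IsStarProjection Q := isStarProjection_starProjection
  have hδ0 : 0 ≤ δ := by linarith [norm_nonneg R]
  refine ⟨1 - Q, hQp.one_sub, fun B hB ↦ ?_, ?_⟩
  · refine (Commute.one_left B).sub_left (commute_starProjection_ker hpos ?_)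
    exact hB.cfcₙ_real _
  have h1 : R⁺ * Q = 0 := by
    ext x
    exact Submodule.starProjection_apply_mem (R⁺).ker x
  have h1' : Q * R⁺ = 0 := by
    simpa [hpos.star_eq, hQp.isSelfAdjoint.star_eq] using congrArg star h1
  -- The range of `R⁻` lies in the kernel of `R⁺`.
  have h2 : Q * R⁻ = R⁻ := by
    ext x
    refine Submodule.starProjection_eq_self_iff.2 ?_
    exact congrArg (fun S : H →L[ℂ] H ↦ S x) (CFC.posPart_mul_negPart R)
  set S : H →L[ℂ] H := (1 - Q) - (1 - (1 - Q)) with hS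
  have hSs : star S = S := by
    simp [hS, hQp.isSelfAdjoint.star_eq]
  have hSS : S * S = 1 := by
    have := hQp.isIdempotentElem.eq
    simp only [hS]
    noncomm_ring
    rw [this]
    abel
  have hSu : S ∈ unitary (H →L[ℂ] H) := by
    rw [Unitary.mem_iff, hSs]
    exact ⟨hSS, hSS⟩
  have hSR : S * CFC.abs R = R := by
    rw [← CFC.posPart_add_negPart R hR]
    conv_rhs => rw [← CFC.posPart_sub_negPart R hR]
    simp only [hS]
    have : (1 - Q - (1 - (1 - Q))) * (R⁺ + R⁻) = R⁺ + R⁻ - 2 • (Q * R⁺ + Q * R⁻) := by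
      noncomm_ring
    rw [this, h1', h2]
    noncomm_ring
  have : R - δ • S = S * (CFC.abs R - algebraMap ℝ _ δ) := by
    rw [mul_sub, hSR, Algebra.algebraMap_eq_smul_one, mul_smul_comm, mul_one]
  rw [this, CStarRing.norm_mem_unitary_mul _ hSu, CFC.abs_eq_cfc_norm R hR,
    ← cfc_const δ R hR, ← cfc_sub ..]
  refine norm_cfc_le hδ0 fun x hx ↦ ?_
  -- `H` may be zero, so only `‖1‖ ≤ 1` is available.
  have hx' : ‖x‖ ≤ 2 * δ := (spectrum.norm_le_norm_mul_of_mem hx).trans <|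
    (mul_le_of_le_one_right (norm_nonneg R) ContinuousLinearMap.norm_id_le).trans hδ
  rw [Real.norm_eq_abs, abs_le]
  constructor <;> linarith [norm_nonneg x]

/-- A self-adjoint operator is approximated at a geometric rate by real combinations of orthogonal
projections from its bicommutant forming a resolution of the identity. -/
lemma exists_orthogonal_resolution_norm_sub_le {T : H →L[ℂ] H} (hT : IsSelfAdjoint T) (n : ℕ) :
    ∃ (ι : Type) (_ : Fintype ι) (c : ι → ℝ) (p : ι → H →L[ℂ] H),
      (∀ i, IsStarProjection (p i)) ∧ (∀ i j, i ≠ j → p i * p j = 0) ∧ ∑ i, p i = 1 ∧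
      (∀ i B, Commute T B → Commute (p i) B) ∧ ‖T - ∑ i, c i • p i‖ ≤ ‖T‖ / 2 ^ n := by
  induction n with
  | zero =>
    exact ⟨Unit, inferInstance, fun _ ↦ 0, fun _ ↦ 1, fun _ ↦ .one _, fun i j h ↦ (h rfl).elim,
      by simp, fun _ B _ ↦ Commute.one_left B, by simp⟩
  | succ n ih =>
    obtain ⟨ι, _, c, p, hp, hpp, hp1, hpc, hn⟩ := ih
    set b := ∑ i, c i • p i with hb
    have hbsa : IsSelfAdjoint b :=
      isSelfAdjoint_sum _ fun i _ ↦ (IsSelfAdjoint.all (c i)).smul (hp i).isSelfAdjoint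
    have hδ : ‖T - b‖ ≤ 2 * (‖T‖ / 2 ^ (n + 1)) := hn.trans_eq (by rw [pow_succ]; field_simp)
    obtain ⟨q, hq, hqc, hqn⟩ := exists_isStarProjection_norm_sub_smul_le (hT.sub hbsa) hδ
    set δ := ‖T‖ / 2 ^ (n + 1)
    have hqT : ∀ B, Commute T B → Commute q B := fun B hB ↦ hqc B <| hB.sub_left <|
      Commute.sum_left _ _ _ fun i _ ↦ (hpc i B hB).smul_left _
    have hqp : ∀ i, Commute (p i) q := fun i ↦ hpc i q (hqT T (Commute.refl T)).symm
    let r : Bool → H →L[ℂ] H := fun s ↦ cond s q (1 - q)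
    have hr : ∀ s, IsStarProjection (r s) := by rintro (_ | _); exacts [hq.one_sub, hq]
    have hrT : ∀ s B, Commute T B → Commute (r s) B := by
      rintro (_ | _) B hB
      exacts [(Commute.one_left B).sub_left (hqT B hB), hqT B hB]
    have hrp : ∀ s i, Commute (p i) (r s) := by
      rintro (_ | _) i
      exacts [(Commute.one_right _).sub_right (hqp i), hqp i]
    have hrr : ∀ s t, s ≠ t → r s * r t = 0 := by
      rintro (_ | _) (_ | _) h
      exacts [(h rfl).elim, hq.one_sub_mul_self, hq.mul_one_sub_self, (h rfl).elim]
    have hmul : ∀ i j s t, p i * r s * (p j * r t) = p i * p j * (r s * r t) := by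
      intro i j s t
      rw [mul_assoc, ← mul_assoc (r s), ← (hrp s j).eq]
      simp only [mul_assoc]
    -- Each `p i` splits into `p i * q` and `p i * (1 - q)`, with coefficients `c i + δ` and `c i -
    -- δ`.
    refine ⟨ι × Bool, inferInstance, fun x ↦ c x.1 + cond x.2 δ (-δ), fun x ↦ p x.1 * r x.2,
      fun x ↦ (hp _).mul (hr _) (hrp _ _), ?_, ?_,
      fun x B hB ↦ (hpc _ B hB).mul_left (hrT _ B hB), ?_⟩
    · rintro ⟨i, s⟩ ⟨j, t⟩ h
      rw [hmul]
      by_cases hij : i = j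
      · rw [hrr s t (fun hst ↦ h (by rw [hij, hst])), mul_zero]
      · rw [hpp i j hij, zero_mul]
    · simp [Fintype.sum_prod_type, r, mul_sub, hp1]
    · convert hqn using 2
      rw [sub_sub]
      congr 1
      have hsum : δ • (q - (1 - q)) = ∑ i, δ • (p i * q - p i * (1 - q)) := by
        rw [← Finset.smul_sum]
        simp only [← mul_sub]
        rw [← Finset.sum_mul, hp1, one_mul]
      rw [hsum, hb, ← Finset.sum_add_distrib, Fintype.sum_prod_type]
      refine Finset.sum_congr rfl fun i _ ↦ ?_
      simp only [Fintype.sum_bool, r, cond_true, cond_false, mul_sub, mul_one]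
      module

/-- Operators of finite spectral type are dense in the self-adjoint operators. -/
lemma exists_mem_orthogonalProjectionCombinations_norm_sub_lt {T : H →L[ℂ] H}
    (hT : IsSelfAdjoint T) {ε : ℝ} (hε : 0 < ε) :
    ∃ b ∈ orthogonalProjectionCombinations (H →L[ℂ] H), ‖T - b‖ < ε := by
  obtain ⟨n, hn⟩ := exists_pow_lt_of_lt_one (div_pos hε (by positivity : 0 < ‖T‖ + 1))
    (by norm_num : (1 / 2 : ℝ) < 1)
  obtain ⟨ι, _, c, p, hp, hpp, -, -, h⟩ := exists_orthogonal_resolution_norm_sub_le hT n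
  refine ⟨_, sum_smul_mem_orthogonalProjectionCombinations c p hp hpp, ?_⟩
  simp only [Complex.coe_smul]
  refine h.trans_lt ?_
  rw [lt_div_iff₀ (by positivity)] at hn
  calc ‖T‖ / 2 ^ n = (1 / 2) ^ n * ‖T‖ := by rw [one_div, inv_pow]; ring
    _ ≤ (1 / 2) ^ n * (‖T‖ + 1) := by gcongr; linarith
    _ < ε := hn

end Operator

/-- Over a profinite space, approximability of self-adjoint elements by combinations of orthogonal
projections passes from a C⋆-algebra to the algebra of continuous functions into it. -/
lemma closure_orthogonalProjectionCombinations_continuousMap {X : Type*} [TopologicalSpace X]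
    [CompactSpace X] [T2Space X] [TotallyDisconnectedSpace X] {A : Type*} [CStarAlgebra A]
    (hA : ∀ a : A, IsSelfAdjoint a → ∀ ε > 0,
      ∃ b ∈ orthogonalProjectionCombinations A, ‖a - b‖ < ε) :
    closure (orthogonalProjectionCombinations C(X, A)) = {a : C(X, A) | IsSelfAdjoint a} := by
  refine subset_antisymm (closure_minimal
    (fun a ha ↦ isSelfAdjoint_of_mem_orthogonalProjectionCombinations ha)
    (isClosed_eq continuous_star continuous_id)) fun a (ha : IsSelfAdjoint a) ↦ ?_
  refine Metric.mem_closure_iff.2 fun ε hε ↦ ?_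
  have hS : {z : A × A | dist z.1 z.2 < ε / 8} ∈ nhdsSet (Set.diagonal A) := by
    refine (isOpen_lt (by fun_prop) (by fun_prop)).mem_nhdsSet.2 ?_
    rintro ⟨x, y⟩ (rfl : x = y)
    simp only [Set.mem_ofPred_eq, dist_self]
    positivity
  obtain ⟨n, g, h, hg, hgh⟩ := a.exists_finite_approximation_of_mem_nhds_diagonal hS
  have hex : ∀ k : Fin n, ∃ b ∈ orthogonalProjectionCombinations A,
      ∀ x, g x = k → dist (a x) b < ε / 2 := by
    intro k
    by_cases hk : ∃ x, g x = k
    · obtain ⟨x, rfl⟩ := hk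
      -- The value `h (g x)` need not be self-adjoint, so a sample value of `a` is approximated
      -- instead; the three errors total `3ε/8`.
      have hax : IsSelfAdjoint (a x) := congrArg (fun f : C(X, A) ↦ f x) ha
      obtain ⟨b, hb, hab⟩ := hA (a x) hax (ε / 8) (by positivity)
      refine ⟨b, hb, fun y hy ↦ ?_⟩
      rw [← dist_eq_norm] at hab
      have h1 : dist (a y) (h (g x)) < ε / 8 := hy ▸ hgh y
      have h2 : dist (a x) (h (g x)) < ε / 8 := hgh x
      linarith [dist_triangle (a y) (h (g x)) b, dist_triangle (h (g x)) (a x) b,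
        dist_comm (a x) (h (g x))]
    · push Not at hk
      exact ⟨0, ⟨0, 0, 0, by simp, by simp, by simp⟩, fun x hx ↦ (hk x hx).elim⟩
  choose b hb hab using hex
  choose m c p hp hpp hbe using hb
  -- Each projection is extended by zero off the clopen fibre of `g` over `k`; distinct fibres are
  -- disjoint.
  let P : (Σ k, Fin (m k)) → C(X, A) := fun s ↦
    ⟨fun x ↦ if g x = s.1 then p s.1 s.2 else 0,
      (continuous_of_discreteTopology (f := fun k ↦ if k = s.1 then p s.1 s.2 else 0)).comp hg⟩
  have hPapp : ∀ s x, P s x = if g x = s.1 then p s.1 s.2 else 0 := fun _ _ ↦ rfl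
  refine ⟨_, sum_smul_mem_orthogonalProjectionCombinations (fun s : Σ k, Fin (m k) ↦ c s.1 s.2) P
    ?_ ?_, ?_⟩
  · intro s
    constructor
    · ext x
      rw [ContinuousMap.mul_apply, hPapp]
      split_ifs
      exacts [(hp _ _).isIdempotentElem, mul_zero 0]
    · ext x
      rw [ContinuousMap.star_apply, hPapp]
      split_ifs
      exacts [(hp _ _).isSelfAdjoint, star_zero A]
  · rintro ⟨k, i⟩ ⟨l, j⟩ hne
    ext x
    rw [ContinuousMap.mul_apply, hPapp, hPapp, ContinuousMap.zero_apply]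
    dsimp only
    split_ifs with h1 h2
    · obtain rfl : k = l := h1.symm.trans h2
      exact hpp k i j fun hij ↦ hne (by rw [hij])
    all_goals simp
  · refine ((ContinuousMap.dist_le (by positivity)).2 fun x ↦ ?_).trans_lt (half_lt_self hε)
    refine le_of_eq_of_le (congrArg _ ?_) (hab (g x) x rfl).le
    rw [hbe, ContinuousMap.sum_apply, Fintype.sum_sigma, Fintype.sum_eq_single (g x)]
    · simp [hPapp]
    · intro k hk
      simp [hPapp, hk.symm]

theorem corollary1p3 {X : Type*} [TopologicalSpace X] [CompactSpace X] [T2Space X]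
    [ExtremallyDisconnected X]
    {H : Type*} [NormedAddCommGroup H] [InnerProductSpace ℂ H] [CompleteSpace H] :
    closure (orthogonalProjectionCombinations C(X, H →L[ℂ] H)) =
        {a : C(X, H →L[ℂ] H) | IsSelfAdjoint a} ∧
      Dense (Submodule.span ℂ {p : C(X, H →L[ℂ] H) | IsStarProjection p} :
        Set C(X, H →L[ℂ] H)) := by
  have hsa : closure (orthogonalProjectionCombinations C(X, H →L[ℂ] H)) =
      {a : C(X, H →L[ℂ] H) | IsSelfAdjoint a} :=
    closure_orthogonalProjectionCombinations_continuousMap fun T hT ε hε ↦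
      exists_mem_orthogonalProjectionCombinations_norm_sub_lt hT hε
  refine ⟨hsa, fun a ↦ ?_⟩
  let M := (Submodule.span ℂ {p : C(X, H →L[ℂ] H) | IsStarProjection p}).topologicalClosure
  have hM : ∀ b : C(X, H →L[ℂ] H), IsSelfAdjoint b → b ∈ M := fun b hb ↦
    closure_mono (orthogonalProjectionCombinations_subset_span _) (hsa.ge hb)
  change a ∈ M
  rw [← realPart_add_I_smul_imaginaryPart a]
  exact M.add_mem (hM _ (realPart a).2) (M.smul_mem _ (hM _ (imaginaryPart a).2))
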